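/- For $n\ge 1$, the Lucas cube $\Lambda_n$ is the graph whose vertices are the binary strings $u_1u_2\cdots u_n$ of length $n$ that have no two consecutive 1s and do not both begin and end with 1 (so the string $1$ is excluded when $n=1$), two vertices being adjacent if they differ in exactly one position. Let $o_V(\Lambda_n)$ be the number of orbits of the automorphism group $\mathrm{Aut}(\Lambda_n)$ acting on the vertex set of $\Lambda_n$. Let $L_0=2$, $L_1=1$, $L_m=L_{m-1}+L_{m-2}$ for $m\ge 2$ be the Lucas numbers, and let $\varphi$ be Euler's totient function. Then for every integer $n\ge 1$, \[ o_V(\Lambda_n)\ =\ \frac12\left(\frac1n\sum_{d\mid n}\varphi\!\left(\frac nd\right)L_d\ +\ \sum_{0\le a\le\lfloor n/2\rfloor}\binom{\lfloor n/2\rfloor-\lfloor (a+1)/2\rfloor}{\lfloor a/2\rfloor}\right), \] where $d$ runs over the positive divisors of $n$. -/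

import Mathlib

/-- The `n`-cube: binary strings of length `n`, adjacent when they differ in exactly one
position. -/
def hypercube (n : ℕ) : SimpleGraph (Fin n → Bool) where
  Adj u v := ∃! i, u i ≠ v i
  symm := ⟨fun u v h => by simpa only [ne_comm] using h⟩
  loopless := ⟨fun u h => by obtain ⟨i, hi, _⟩ := h; exact hi rfl⟩

/-- A binary string with no two consecutive 1s. -/
def IsFibonacciString {n : ℕ} (u : Fin n → Bool) : Prop :=
  ∀ i j : Fin n, (j : ℕ) = (i : ℕ) + 1 → ¬ (u i = true ∧ u j = true)

/-- A Fibonacci string that does not both begin and end with 1 (for `n = 1` the first and the last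
position coincide, so that the string `1` is excluded). -/
def IsLucasString {n : ℕ} (u : Fin n → Bool) : Prop :=
  IsFibonacciString u ∧
    ∀ i j : Fin n, (i : ℕ) = 0 → (j : ℕ) + 1 = n → ¬ (u i = true ∧ u j = true)

/-- The Lucas cube: the subgraph of the `n`-cube induced by the Lucas strings. -/
def lucasCube (n : ℕ) : SimpleGraph {u : Fin n → Bool | IsLucasString u} :=
  (hypercube n).induce {u : Fin n → Bool | IsLucasString u}

/-- The number of orbits of the automorphism group of `G` acting on the vertices of `G`. -/
noncomputable def vertexOrbitCount {V : Type*} (G : SimpleGraph V) : ℕ :=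
  Nat.card (MulAction.orbitRel.Quotient (G ≃g G) V)

/-- The Lucas numbers `2, 1, 3, 4, 7, 11, …`. -/
def lucasNumber : ℕ → ℕ
  | 0 => 2
  | 1 => 1
  | n + 2 => lucasNumber (n + 1) + lucasNumber n

/-! Reading positions modulo `n` turns Lucas strings into cyclic words without two neighbouring 1s,
on which the dihedral group of order `2 * n` acts by automorphisms. These are all the automorphisms.
For `n ≥ 2` the zero word is the only vertex where every letter may be flipped, so it is fixed. The
words with a single 1 are then permuted, and this permutation respects cyclic adjacency, because two
positions can carry 1s together exactly when they are not adjacent. Heavier words are determined by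
induction on the number of 1s, since squares of the cube close up uniquely
(`exists_dihedral_of_preserves_adj`).

Burnside's lemma for the dihedral group then counts the orbits. Rotation by `k` fixes as many words
as there are on a cycle of length `gcd(n, k)`, a Lucas number. Words fixed by a reflection unfold
from Fibonacci strings on half the cycle, and reflections contribute `fib (n / 2 + 2)` on average.
The binomial sum equals this Fibonacci number by Pascal's rule. -/

/-! ### Cyclic words and the dihedral action -/

/-- A cyclic binary word with no two cyclically consecutive 1s. -/
def IsCyclicLucas {n : ℕ} (u : ZMod n → Bool) : Prop :=
  ∀ i, ¬ (u i = true ∧ u (i + 1) = true)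

/-- The cyclic binary words of length `n` with no two cyclically consecutive 1s. -/
abbrev CyclicLucasWord (n : ℕ) := {u : ZMod n → Bool // IsCyclicLucas u}

theorem IsCyclicLucas.mono {n : ℕ} {u v : ZMod n → Bool} (hu : IsCyclicLucas u)
    (h : ∀ i, v i = true → u i = true) : IsCyclicLucas v :=
  fun i hi => hu i ⟨h _ hi.1, h _ hi.2⟩

/-- The dihedral group acts on `ZMod n` by the maps `i ↦ a ± i`. -/
instance dihedralMulActionZMod (n : ℕ) : MulAction (DihedralGroup n) (ZMod n) where
  smul g i := match g with
    | .r a => a + i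
    | .sr a => -a - i
  one_smul i := zero_add i
  mul_smul g h i := by
    rcases g with a | a <;> rcases h with b | b
    · change a + b + i = a + (b + i); ring
    · change -(b - a) - i = a + (-b - i); ring
    · change -(a + b) - i = -a - (b + i); ring
    · change b - a + i = -a - (-b - i); ring

theorem r_smul_zmod {n : ℕ} (a i : ZMod n) : DihedralGroup.r a • i = a + i := rfl

theorem sr_smul_zmod {n : ℕ} (a i : ZMod n) : DihedralGroup.sr a • i = -a - i := rfl

theorem IsCyclicLucas.comp_smul {n : ℕ} {u : ZMod n → Bool} (hu : IsCyclicLucas u)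
    (g : DihedralGroup n) : IsCyclicLucas (fun i => u (g • i)) := by
  intro i hi
  rcases g with a | a
  · simp only [r_smul_zmod, ← add_assoc] at hi
    exact hu _ hi
  · simp only [sr_smul_zmod] at hi
    refine hu (-a - (i + 1)) ⟨hi.2, ?_⟩
    rw [← hi.1]
    congr 1
    ring

instance dihedralMulActionWord (n : ℕ) : MulAction (DihedralGroup n) (CyclicLucasWord n) where
  smul g u := ⟨fun i => u.1 (g⁻¹ • i), u.2.comp_smul g⁻¹⟩
  one_smul u := Subtype.ext <| funext fun i => by
    change u.1 ((1 : DihedralGroup n)⁻¹ • i) = u.1 i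
    rw [inv_one, one_smul]
  mul_smul g h u := Subtype.ext <| funext fun i => by
    change u.1 ((g * h)⁻¹ • i) = u.1 (h⁻¹ • g⁻¹ • i)
    rw [mul_inv_rev, mul_smul]

theorem smul_word_apply {n : ℕ} (g : DihedralGroup n) (u : CyclicLucasWord n) (i : ZMod n) :
    (g • u).1 i = u.1 (g⁻¹ • i) := rfl

/-! ### Flips and squares in the hypercube -/

/-- Change the letter in position `p`. -/
def flipAt {ι : Type*} [DecidableEq ι] (u : ι → Bool) (p : ι) : ι → Bool :=
  Function.update u p (!u p)

section FlipAt

variable {ι : Type*} [DecidableEq ι]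

theorem flipAt_apply (u : ι → Bool) (p i : ι) :
    flipAt u p i = if i = p then !u i else u i := by
  unfold flipAt
  rw [Function.update_apply]
  split_ifs with h <;> simp [h]

theorem existsUnique_ne_iff (u v : ι → Bool) : (∃! i, u i ≠ v i) ↔ ∃ p, v = flipAt u p := by
  constructor
  · rintro ⟨p, hp, h⟩
    refine ⟨p, funext fun i => ?_⟩
    rw [flipAt_apply]
    split_ifs with hi
    · subst hi
      revert hp
      cases u i <;> cases v i <;> simp
    · by_contra hne
      exact hi (h i (Ne.symm hne))
  · rintro ⟨p, rfl⟩
    refine ⟨p, by simp [flipAt_apply], fun i hi => ?_⟩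
    by_contra hne
    exact hi (by simp [flipAt_apply, hne])

theorem flipAt_injective (u : ι → Bool) : Function.Injective (flipAt u) := by
  intro p q h
  by_contra hne
  have := congrFun h p
  simp [flipAt_apply, hne] at this

theorem flipAt_flipAt (u : ι → Bool) (p : ι) : flipAt (flipAt u p) p = u := by
  funext i
  by_cases h : i = p <;> simp [flipAt_apply, h]

theorem flipAt_comm (u : ι → Bool) (p q : ι) :
    flipAt (flipAt u p) q = flipAt (flipAt u q) p := by
  funext i
  simp only [flipAt_apply]
  split_ifs <;> rfl

/-- Either `a` undoes the flip at `p`, or comparing the two expressions for `u` at position `p`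
forces `b = p`. This is the rigidity of squares: once `x` is excluded, the fourth corner is
determined. -/
theorem eq_or_eq_of_flipAt {x u : ι → Bool} {p q a b : ι} (hpq : p ≠ q)
    (ha : u = flipAt (flipAt x p) a) (hb : u = flipAt (flipAt x q) b) :
    u = x ∨ u = flipAt (flipAt x p) q := by
  by_cases hap : a = p
  · left
    rw [ha, hap, flipAt_flipAt]
  · right
    have hp := congrFun (ha.symm.trans hb) p
    have hbp : p = b := by
      by_contra h
      simp [flipAt_apply, h, hpq, Ne.symm hap] at hp
    rw [hb, ← hbp, flipAt_comm]

end FlipAt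

/-! ### Adjacency-preserving maps are dihedral -/

/-- An injective map of `ZMod n` that preserves cyclic adjacency is of the form `i ↦ a ± i`. -/
theorem exists_smul_eq_of_preserves_adj {n : ℕ} [NeZero n] (τ : ZMod n → ZMod n)
    (hτ : Function.Injective τ)
    (h : ∀ i, i ≠ i + 1 → τ (i + 1) = τ i + 1 ∨ τ i = τ (i + 1) + 1) :
    ∃ g : DihedralGroup n, ∀ i, τ i = g • i := by
  -- The first step fixes the direction `ε`; injectivity forbids turning back.
  have key : ∀ ε : ZMod n, (ε = 1 ∨ ε = -1) → τ 1 = τ 0 + ε → ∀ i, τ i = τ 0 + ε * i := by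
    intro ε hε h1
    have main : ∀ m : ℕ, τ m = τ 0 + ε * m ∧ τ (m + 1) = τ 0 + ε * (m + 1) := by
      intro m
      induction m with
      | zero => simpa using h1
      | succ m ih =>
        push_cast
        refine ⟨ih.2, ?_⟩
        by_cases hne : (m + 1 : ZMod n) = m + 1 + 1
        · have h0 : (1 : ZMod n) = 0 := by linear_combination -hne
          have := subsingleton_of_zero_eq_one h0.symm
          exact Subsingleton.elim _ _
        -- Only for `n = 2` does the walk legitimately return after two steps.
        by_cases h2 : (m + 1 + 1 : ZMod n) = m
        · rw [h2, ih.1]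
        have h2' : τ (m + 1 + 1) ≠ τ m := fun e => h2 (hτ e)
        rcases h _ hne with h3 | h3 <;> rcases hε with rfl | rfl
        · rw [h3, ih.2]; ring
        · refine absurd ?_ h2'
          rw [h3, ih.1, ih.2]; ring
        · refine absurd ?_ h2'
          linear_combination -h3 + ih.2 - ih.1
        · linear_combination -h3 + ih.2
    intro i
    have := (main i.val).1
    rwa [ZMod.natCast_zmod_val] at this
  by_cases h01 : (0 : ZMod n) = 0 + 1
  · have := subsingleton_of_zero_eq_one (h01.trans (zero_add 1))
    exact ⟨1, fun i => Subsingleton.elim _ _⟩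
  rcases h 0 h01 with h1 | h1
  · rw [zero_add] at h1
    refine ⟨.r (τ 0), fun i => ?_⟩
    rw [r_smul_zmod, key 1 (.inl rfl) h1 i, one_mul]
  · rw [zero_add] at h1
    refine ⟨.sr (-τ 0), fun i => ?_⟩
    rw [sr_smul_zmod, key (-1) (.inr rfl) (by rw [h1]; ring) i]
    ring

/-- Every adjacency-preserving bijection of the cyclic Lucas words is given by a dihedral symmetry
of the positions. -/
theorem exists_dihedral_of_preserves_adj {n : ℕ} [NeZero n]
    (F : CyclicLucasWord n → CyclicLucasWord n) (hF : Function.Injective F)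
    (hadj : ∀ u v, (∃ p, v.1 = flipAt u.1 p) → ∃ p, (F v).1 = flipAt (F u).1 p) :
    ∃ g : DihedralGroup n, ∀ u, F u = g • u := by
  by_cases hn : n = 1
  · subst hn
    refine ⟨1, fun u => Subtype.ext <| funext fun i => ?_⟩
    have hfalse : ∀ v : CyclicLucasWord 1, v.1 i = false := fun v => by
      have := v.2 i
      rw [Subsingleton.elim (i + 1) i] at this
      simpa using this
    rw [hfalse, hfalse]
  have hsucc : ∀ i : ZMod n, i ≠ i + 1 := by
    intro i h
    have h0 : ((1 : ℕ) : ZMod n) = 0 := by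
      push_cast
      linear_combination -h
    rw [ZMod.natCast_eq_zero_iff] at h0
    exact hn (Nat.dvd_one.mp h0)
  let zw : ZMod n → Bool := fun _ => false
  let z : CyclicLucasWord n := ⟨zw, fun i hi => by simp [zw] at hi⟩
  have he : ∀ i, IsCyclicLucas (flipAt zw i) := by
    intro i j hj
    simp only [flipAt_apply, zw] at hj
    rcases hj with ⟨h1, h2⟩
    have e1 : j = i := by by_contra h; simp [h] at h1
    have e2 : j + 1 = i := by by_contra h; simp [h] at h2
    exact hsucc j (e1.trans e2.symm)
  let e : ZMod n → CyclicLucasWord n := fun i => ⟨flipAt zw i, he i⟩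
  have hπ : ∀ i, ∃ p, (F (e i)).1 = flipAt (F z).1 p := fun i => hadj z (e i) ⟨i, rfl⟩
  choose π hπ using hπ
  have hπinj : Function.Injective π := by
    intro i j hij
    have h1 : F (e i) = F (e j) := Subtype.ext (by rw [hπ, hπ, hij])
    exact flipAt_injective _ (congrArg Subtype.val (hF h1))
  have hπbij : Function.Bijective π := Finite.injective_iff_bijective.mp hπinj
  -- Since `π` is surjective, every letter of `F z` can be flipped; a 1 at `i` would make flipping
  -- `i + 1` illegal.
  have hFz : F z = z := by
    by_contra hne
    obtain ⟨i, hi⟩ : ∃ i, (F z).1 i = true := by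
      by_contra! hall
      refine hne (Subtype.ext <| funext fun i => ?_)
      simpa using hall i
    obtain ⟨j, hj⟩ := hπbij.2 (i + 1)
    refine (F (e j)).2 i ?_
    rw [hπ, hj]
    have := (F z).2 i
    rw [hi] at this
    simpa [flipAt_apply, hsucc i, hi] using this
  have hFe : ∀ i, (F (e i)).1 = flipAt zw (π i) := fun i => by rw [hπ, hFz]
  let P : ZMod n ≃ ZMod n := Equiv.ofBijective π hπbij
  -- If the preimages `i`, `j` of `k`, `k + 1` were not adjacent, the word with 1s at `i` and `j`
  -- would be mapped either to the zero word or to one with 1s at `k` and `k + 1`; both are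
  -- impossible.
  have hPadj : ∀ i, i ≠ i + 1 →
      P.symm (i + 1) = P.symm i + 1 ∨ P.symm i = P.symm (i + 1) + 1 := by
    intro k hk
    by_contra! hcon
    set i := P.symm k with hi
    set j := P.symm (k + 1) with hj
    have hπi : π i = k := P.apply_symm_apply k
    have hπj : π j = k + 1 := P.apply_symm_apply (k + 1)
    have hij : i ≠ j := fun h => hk (hπi.symm.trans ((congrArg π h).trans hπj))
    have hw : IsCyclicLucas (flipAt (flipAt zw i) j) := by
      intro a ha
      simp only [flipAt_apply, zw] at ha
      have h1 : a = i ∨ a = j := by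
        by_contra! h; simp [h] at ha
      have h2 : a + 1 = i ∨ a + 1 = j := by
        by_contra! h; simp [h] at ha
      rcases h1 with rfl | rfl <;> rcases h2 with h2 | h2
      · exact hsucc _ h2.symm
      · exact hcon.1 h2.symm
      · exact hcon.2 h2.symm
      · exact hsucc _ h2.symm
    let w : CyclicLucasWord n := ⟨_, hw⟩
    obtain ⟨a, ha⟩ := hadj (e i) w ⟨j, rfl⟩
    obtain ⟨b, hb⟩ := hadj (e j) w ⟨i, flipAt_comm _ _ _⟩
    rw [hFe] at ha hb
    rcases eq_or_eq_of_flipAt (hπinj.ne hij) ha hb with h | h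
    · have : w = z := hF (Subtype.ext (by rw [h, hFz]))
      have := congrFun (congrArg Subtype.val this) i
      simp [w, z, zw, flipAt_apply, hij] at this
    · refine (F w).2 k ?_
      rw [h, hπi, hπj]
      simp [flipAt_apply, zw, hsucc k, (hsucc k).symm]
  obtain ⟨g, hg⟩ := exists_smul_eq_of_preserves_adj P.symm P.symm.injective hPadj
  have hcomp : ∀ (u : ZMod n → Bool) (p : ZMod n),
      (fun i => flipAt u p (P.symm i)) = flipAt (fun i => u (P.symm i)) (π p) := by
    intro u p
    funext i
    have : P.symm i = p ↔ i = π p := P.symm_apply_eq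
    simp only [flipAt_apply, this]
  -- Induction on the number of 1s. Given two 1s at `i` and `j`, erasing either or both completes a
  -- square whose other three corners have known images. The image of `u` is then the fourth corner,
  -- as injectivity excludes `F x`.
  have main : ∀ (m : ℕ) (u : CyclicLucasWord n),
      (Finset.univ.filter fun i => u.1 i = true).card = m →
        (F u).1 = fun i => u.1 (P.symm i) := by
    intro m
    induction m using Nat.strong_induction_on with
    | _ m ih =>
      intro u hu
      rcases Nat.lt_or_ge 1 m with hm | hm
      · rw [← hu, Finset.one_lt_card] at hm
        obtain ⟨i, hi, j, hj, hij⟩ := hm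
        simp only [Finset.mem_filter, Finset.mem_univ, true_and] at hi hj
        have hsub : ∀ {v : ZMod n → Bool} {k}, v k = true → ∀ a, flipAt v k a = true →
            v a = true := by
          intro v k hk a ha
          by_cases hak : a = k
          · rwa [hak]
          · simpa [flipAt_apply, hak] using ha
        have hlt : ∀ (v : CyclicLucasWord n) (k : ZMod n), u.1 k = true → v.1 k = false →
            (∀ a, v.1 a = true → u.1 a = true) →
            (F v).1 = fun i => v.1 (P.symm i) := by
          intro v k hk hvk hv
          refine ih _ ?_ v rfl
          rw [← hu]
          refine Finset.card_lt_card ⟨fun a ha => ?_, fun hs => ?_⟩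
          · simp only [Finset.mem_filter, Finset.mem_univ, true_and] at ha ⊢
            exact hv a ha
          · have := @hs k (by simpa using hk)
            simp [hvk] at this
        have hxi : flipAt u.1 i j = true := by simp [flipAt_apply, hij.symm, hj]
        have sx : ∀ a, flipAt (flipAt u.1 i) j a = true → u.1 a = true :=
          fun a ha => hsub hi a (hsub hxi a ha)
        let vi : CyclicLucasWord n := ⟨flipAt u.1 i, u.2.mono (hsub hi)⟩
        let vj : CyclicLucasWord n := ⟨flipAt u.1 j, u.2.mono (hsub hj)⟩
        let x : CyclicLucasWord n := ⟨flipAt (flipAt u.1 i) j, u.2.mono sx⟩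
        have hvi : (F vi).1 = fun i => vi.1 (P.symm i) :=
          hlt vi i hi (by simp [vi, flipAt_apply, hi]) (hsub hi)
        have hvj : (F vj).1 = fun i => vj.1 (P.symm i) :=
          hlt vj j hj (by simp [vj, flipAt_apply, hj]) (hsub hj)
        have hx : (F x).1 = fun i => x.1 (P.symm i) :=
          hlt x i hi (by simp [x, flipAt_apply, hi, hij]) sx
        have hvix : vi.1 = flipAt x.1 j := (flipAt_flipAt _ _).symm
        have hvjx : vj.1 = flipAt x.1 i := by
          change _ = flipAt (flipAt (flipAt u.1 i) j) i
          rw [flipAt_comm u.1 i j, flipAt_flipAt]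
        obtain ⟨a, ha⟩ := hadj vi u ⟨i, (flipAt_flipAt _ _).symm⟩
        obtain ⟨b, hb⟩ := hadj vj u ⟨j, (flipAt_flipAt _ _).symm⟩
        rw [hvi, hvix, hcomp, ← hx] at ha
        rw [hvj, hvjx, hcomp, ← hx] at hb
        rcases eq_or_eq_of_flipAt (hπinj.ne hij.symm) ha hb with h | h
        · have hux : u = x := hF (Subtype.ext h)
          have := congrFun (congrArg Subtype.val hux) i
          simp [x, flipAt_apply, hi, hij] at this
        · rw [h, hx, ← hcomp, ← hcomp, ← hvix]
          funext k
          exact congrFun (flipAt_flipAt u.1 i) (P.symm k)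
      · rcases Nat.eq_zero_or_pos m with h0 | hpos
        · have huz : u = z := Subtype.ext <| funext fun i => by
            rw [h0, Finset.card_eq_zero, Finset.filter_eq_empty_iff] at hu
            simpa using hu (Finset.mem_univ i)
          rw [huz, hFz]
        · have h1 : m = 1 := le_antisymm hm hpos
          rw [h1, Finset.card_eq_one] at hu
          obtain ⟨a, ha⟩ := hu
          have hue : u = e a := Subtype.ext <| funext fun i => by
            have := Finset.ext_iff.mp ha i
            simp only [Finset.mem_filter, Finset.mem_univ, true_and, Finset.mem_singleton] at this
            by_cases hia : i = a
            · simpa [e, zw, flipAt_apply, hia] using this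
            · simpa [e, zw, flipAt_apply, hia] using this
          rw [hue, hFe]
          exact (hcomp zw a).symm
  refine ⟨g⁻¹, fun u => Subtype.ext <| funext fun i => ?_⟩
  rw [main _ u rfl, smul_word_apply, inv_inv, ← hg]

theorem smul_preserves_adj {n : ℕ} (g : DihedralGroup n) {u v : CyclicLucasWord n}
    (h : ∃ p, v.1 = flipAt u.1 p) : ∃ p, (g • v).1 = flipAt (g • u).1 p := by
  obtain ⟨p, hp⟩ := h
  refine ⟨g • p, funext fun i => ?_⟩
  have : g⁻¹ • i = p ↔ i = g • p := inv_smul_eq_iff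
  simp only [smul_word_apply, hp, flipAt_apply, this]

/-! ### From the Lucas cube to dihedral orbits -/

theorem isLucasString_iff_isCyclicLucas {m : ℕ} (u : Fin (m + 1) → Bool) :
    IsLucasString u ↔ IsCyclicLucas (n := m + 1) u := by
  have hval : ∀ i : Fin (m + 1), ((i + 1 : Fin (m + 1)) : ℕ) =
      if (i : ℕ) = m then 0 else (i : ℕ) + 1 := by
    intro i
    rw [Fin.val_add_one]
    simp [Fin.ext_iff]
  change IsLucasString u ↔ ∀ i : Fin (m + 1), ¬ (u i = true ∧ u (i + 1) = true)
  constructor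
  · rintro ⟨h1, h2⟩ i ⟨hi, hi'⟩
    by_cases him : (i : ℕ) = m
    · exact h2 (i + 1) i (by rw [hval, if_pos him]) (by rw [him]) ⟨hi', hi⟩
    · exact h1 i (i + 1) (by rw [hval, if_neg him]) ⟨hi, hi'⟩
  · intro h
    refine ⟨fun i j hij => ?_, fun i j hi hj => ?_⟩
    · have : j = i + 1 := by
        apply Fin.ext
        rw [hval, hij, if_neg (by omega)]
      rw [this]
      exact h i
    · have : i = j + 1 := by
        apply Fin.ext
        rw [hval, hi, if_pos (by omega)]
      rw [this, and_comm]
      exact h j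

/-- The vertex orbits of the Lucas cube are the dihedral orbits of cyclic Lucas words. -/
theorem vertexOrbitCount_lucasCube {n : ℕ} [NeZero n] :
    vertexOrbitCount (lucasCube n) =
      Nat.card (MulAction.orbitRel.Quotient (DihedralGroup n) (CyclicLucasWord n)) := by
  obtain ⟨m, rfl⟩ := Nat.exists_eq_succ_of_ne_zero (NeZero.ne n)
  let φ : {u : Fin (m + 1) → Bool | IsLucasString u} ≃ CyclicLucasWord (m + 1) :=
    Equiv.subtypeEquivRight isLucasString_iff_isCyclicLucas
  have hφ : ∀ u v, (lucasCube (m + 1)).Adj u v ↔ ∃ p, (φ v).1 = flipAt (φ u).1 p :=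
    fun u v => existsUnique_ne_iff (ι := ZMod (m + 1)) (φ u).1 (φ v).1
  refine Nat.card_congr (Quotient.congr φ fun u v => ?_)
  change u ∈ MulAction.orbit _ v ↔ φ u ∈ MulAction.orbit _ (φ v)
  constructor
  · rintro ⟨f, rfl⟩
    obtain ⟨g, hg⟩ := exists_dihedral_of_preserves_adj (fun w => φ (f (φ.symm w)))
      (fun a b hab => by simpa using hab)
      (fun a b hab => by
        rw [← hφ, f.map_adj_iff, hφ]
        simpa using hab)
    refine ⟨g, ?_⟩
    have := hg (φ v)
    rw [φ.symm_apply_apply] at this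
    exact this.symm
  · rintro ⟨g, hg⟩
    let f : lucasCube (m + 1) ≃g lucasCube (m + 1) :=
      { toEquiv := (φ.trans (MulAction.toPerm g)).trans φ.symm
        map_rel_iff' := by
          intro a b
          rw [hφ, hφ]
          simp only [Equiv.trans_apply, Equiv.apply_symm_apply, MulAction.toPerm_apply]
          refine ⟨fun h => ?_, fun h => smul_preserves_adj g h⟩
          simpa using smul_preserves_adj g⁻¹ h }
    refine ⟨f, ?_⟩
    change φ.symm (g • φ v) = u
    rw [Equiv.symm_apply_eq]
    exact hg

/-! ### Fibonacci strings with conditions on the end letters -/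

/-- The number of Fibonacci strings of length `m + 1` with a condition on the two end letters. -/
noncomputable def fibonacciCount (m : ℕ) (p : Bool → Bool → Bool) : ℕ :=
  Nat.card {w : Fin (m + 1) → Bool // IsFibonacciString w ∧ p (w 0) (w (Fin.last m)) = true}

theorem isFibonacciString_cons {m : ℕ} (a : Bool) (w : Fin (m + 1) → Bool) :
    IsFibonacciString (Fin.cons a w : Fin (m + 2) → Bool) ↔
      IsFibonacciString w ∧ ¬ (a = true ∧ w 0 = true) := by
  constructor
  · intro h
    refine ⟨fun i j hij => ?_, ?_⟩
    · simpa using h i.succ j.succ (by simp [hij])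
    · simpa using h 0 (Fin.succ 0) (by simp)
  · rintro ⟨h1, h2⟩ i j hij
    rcases Fin.eq_zero_or_eq_succ j with rfl | ⟨j, rfl⟩
    · simp at hij
    rcases Fin.eq_zero_or_eq_succ i with rfl | ⟨i, rfl⟩
    · have : j = 0 := Fin.ext (by simpa using hij)
      subst this
      simpa using h2
    · simpa using h1 i j (by simpa using hij)

/-- After a leading 0 the rest is unconstrained; after a leading 1 it must begin with 0. An
arbitrary test `p` on the ends is what lets the recursion close. -/
theorem fibonacciCount_succ (m : ℕ) (p : Bool → Bool → Bool) :
    fibonacciCount (m + 1) p = fibonacciCount m (fun _ b => p false b) +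
      fibonacciCount m (fun a b => !a && p true b) := by
  classical
  unfold fibonacciCount
  simp only [Nat.card_eq_fintype_card, Fintype.card_subtype, Finset.card_filter]
  have hcons : ∀ (a : Bool) (w : Fin (m + 1) → Bool),
      Fin.consEquiv (fun _ : Fin (m + 2) => Bool) (a, w) = (Fin.cons a w : Fin (m + 2) → Bool) :=
    fun _ _ => rfl
  rw [← (Fin.consEquiv fun _ : Fin (m + 2) => Bool).sum_comp, Fintype.sum_prod_type]
  simp only [hcons, isFibonacciString_cons, Fintype.sum_bool, Fin.cons_zero,
    ← Fin.succ_last, Fin.cons_succ]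
  rw [add_comm]
  congr 1
  · simp
  · refine Finset.sum_congr rfl fun w _ => if_congr ?_ rfl rfl
    cases w 0 <;> simp

theorem fibonacciCount_zero (p : Bool → Bool → Bool) :
    fibonacciCount 0 p = (p false false).toNat + (p true true).toNat := by
  classical
  unfold fibonacciCount
  have h : ∀ w : Fin 1 → Bool, IsFibonacciString w := fun w i j hij => by omega
  simp only [Nat.card_eq_fintype_card, Fintype.card_subtype, Finset.card_filter, h, true_and]
  rw [← (Equiv.funUnique (Fin 1) Bool).symm.sum_comp, Fintype.sum_bool, add_comm]
  simp only [Equiv.funUnique_symm_apply, uniqueElim_const]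
  cases p false false <;> cases p true true <;> simp

/-- The terms correspond to the end letters 00, 01 or 10, and 11. The difference in the last term
also gives the correct value 1 at `m = 0`, where both ends are the same letter. -/
theorem fibonacciCount_eq (m : ℕ) (p : Bool → Bool → Bool) :
    fibonacciCount m p = (p false false).toNat * Nat.fib (m + 1)
      + ((p false true).toNat + (p true false).toNat) * Nat.fib m
      + (p true true).toNat * (Nat.fib (m + 1) - Nat.fib m) := by
  induction m generalizing p with
  | zero => simp [fibonacciCount_zero]
  | succ m ih =>
    have hle : Nat.fib m ≤ Nat.fib (m + 1) := Nat.fib_le_fib_succ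
    have h2 : Nat.fib (m + 1 + 1) = Nat.fib m + Nat.fib (m + 1) := Nat.fib_add_two
    obtain ⟨c, hc⟩ := Nat.exists_eq_add_of_le hle
    rw [fibonacciCount_succ, ih, ih]
    have e1 : Nat.fib (m + 1) - Nat.fib m = c := by omega
    have e2 : Nat.fib (m + 1 + 1) - Nat.fib (m + 1) = Nat.fib m := by omega
    simp only [Bool.not_false, Bool.not_true, Bool.true_and, Bool.false_and, Bool.toNat_false,
      e1, e2]
    rw [h2, hc]
    ring

theorem lucasNumber_succ (m : ℕ) : lucasNumber (m + 1) = Nat.fib (m + 1) + 2 * Nat.fib m := by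
  induction m using Nat.twoStepInduction with
  | zero => rfl
  | one => rfl
  | more m h1 h2 =>
    rw [lucasNumber, h1, h2, Nat.fib_add_two (n := m + 1), Nat.fib_add_two (n := m)]
    ring

theorem isLucasString_iff {m : ℕ} (w : Fin (m + 1) → Bool) :
    IsLucasString w ↔ IsFibonacciString w ∧ (!(w 0 && w (Fin.last m))) = true := by
  refine and_congr_right fun _ => ⟨fun h => ?_, fun h i j hi hj => ?_⟩
  · have := h 0 (Fin.last m) rfl rfl
    revert this
    cases w 0 <;> cases w (Fin.last m) <;> simp
  · have e1 : i = 0 := Fin.ext hi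
    have e2 : j = Fin.last m := Fin.ext (by simpa using hj)
    rw [e1, e2]
    revert h
    cases w 0 <;> cases w (Fin.last m) <;> simp

theorem card_cyclicLucasWord (n : ℕ) [NeZero n] :
    Nat.card (CyclicLucasWord n) = lucasNumber n := by
  obtain ⟨m, rfl⟩ := Nat.exists_eq_succ_of_ne_zero (NeZero.ne n)
  have h : Nat.card (CyclicLucasWord (m + 1)) = fibonacciCount m (fun a b => !(a && b)) :=
    Nat.card_congr (Equiv.subtypeEquivRight fun w =>
      (isLucasString_iff_isCyclicLucas w).symm.trans (isLucasString_iff w))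
  rw [Nat.succ_eq_add_one, h, fibonacciCount_eq, lucasNumber_succ]
  simp

/-! ### Words fixed by rotations -/

/-- If the words fixed by `g` are those that factor through `fold`, they can be counted there. -/
theorem card_fixedBy_of_fold {n : ℕ} {B : Type*} (g : DihedralGroup n) (fold : ZMod n → B)
    (hsurj : Function.Surjective fold) (hfold : ∀ i, fold (g⁻¹ • i) = fold i)
    (hfix : ∀ u : ZMod n → Bool, (∀ i, u (g⁻¹ • i) = u i) →
      ∀ i j, fold i = fold j → u i = u j) :
    Nat.card (MulAction.fixedBy (CyclicLucasWord n) g) =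
      Nat.card {w : B → Bool // IsCyclicLucas (w ∘ fold)} := by
  symm
  refine Nat.card_congr (Equiv.ofBijective
    (fun w => ⟨⟨w.1 ∘ fold, w.2⟩, Subtype.ext <| funext fun i => congrArg w.1 (hfold i)⟩)
    ⟨fun w w' h => ?_, fun u => ?_⟩)
  · have := congrArg (fun x => x.1.1) h
    exact Subtype.ext (hsurj.injective_comp_right this)
  · obtain ⟨⟨u, hu⟩, hgu⟩ := u
    have hinv : ∀ i, u (g⁻¹ • i) = u i := fun i => congrFun (congrArg Subtype.val hgu) i
    have hcomp : (fun b => u (Function.surjInv hsurj b)) ∘ fold = u :=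
      funext fun i => hfix u hinv _ _ (Function.surjInv_eq hsurj _)
    exact ⟨⟨fun b => u (Function.surjInv hsurj b), by rwa [hcomp]⟩,
      Subtype.ext (Subtype.ext hcomp)⟩

/-- By Bézout, `k` and `gcd(n, k)` generate the same subgroup of `ZMod n`, so the fixed words are
those pulled back from the shorter cycle. -/
theorem card_fixedBy_r {n : ℕ} [NeZero n] (k : ℕ) :
    Nat.card (MulAction.fixedBy (CyclicLucasWord n) (DihedralGroup.r (k : ZMod n))) =
      lucasNumber (n.gcd k) := by
  have hd : n.gcd k ∣ n := Nat.gcd_dvd_left n k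
  have : NeZero (n.gcd k) := ⟨(Nat.gcd_pos_of_pos_left k (NeZero.pos n)).ne'⟩
  have hk0 : ((k : ℕ) : ZMod (n.gcd k)) = 0 :=
    (ZMod.natCast_eq_zero_iff _ _).mpr (Nat.gcd_dvd_right n k)
  rw [card_fixedBy_of_fold _ (ZMod.castHom hd (ZMod (n.gcd k))) (ZMod.castHom_surjective hd),
    ← card_cyclicLucasWord]
  · refine Nat.card_congr (Equiv.subtypeEquivRight fun w => ?_)
    constructor
    · intro h i
      obtain ⟨j, rfl⟩ := ZMod.castHom_surjective hd i
      simpa only [Function.comp_apply, map_add, map_one] using h j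
    · intro h i
      simpa only [Function.comp_apply, map_add, map_one] using h (ZMod.castHom hd _ i)
  · intro i
    rw [DihedralGroup.inv_r, r_smul_zmod, map_add, map_neg, map_natCast, hk0, neg_zero, zero_add]
  · intro u hu i j hij
    have hmul : ∀ (t : ℕ) (a : ZMod n), u (a + t * k) = u a := by
      intro t a
      induction t with
      | zero => simp
      | succ t ih =>
        rw [← hu, DihedralGroup.inv_r, r_smul_zmod, ← ih]
        congr 1
        push_cast
        ring
    have hdvd : ((n.gcd k : ℕ) : ZMod n) ∣ i - j := by
      have h0 : ZMod.castHom hd (ZMod (n.gcd k)) (((i - j).val : ℕ) : ZMod n) = 0 := by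
        rw [ZMod.natCast_zmod_val, map_sub, hij, sub_self]
      rw [map_natCast, ZMod.natCast_eq_zero_iff] at h0
      have := Nat.cast_dvd_cast (α := ZMod n) h0
      rwa [ZMod.natCast_zmod_val] at this
    obtain ⟨x, hx⟩ := hdvd
    have hgcd : ((n.gcd k : ℕ) : ZMod n) = k * ((n.gcdB k : ℤ) : ZMod n) := by
      have := congrArg (Int.cast : ℤ → ZMod n) (Nat.gcd_eq_gcd_ab n k)
      push_cast at this
      simpa using this
    have hi : i = j + (((n.gcdB k : ZMod n) * x).val : ℕ) * k := by
      rw [ZMod.natCast_zmod_val]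
      linear_combination hx + x * hgcd
    rw [hi, hmul]

/-! ### Words fixed by reflections -/

theorem val_add_one_eq_ite {n : ℕ} [NeZero n] (i : ZMod n) :
    (i + 1).val = if i.val + 1 = n then 0 else i.val + 1 := by
  have hi := i.val_lt
  rw [ZMod.val_add, ZMod.val_one_eq_one_mod, Nat.add_mod_mod]
  split_ifs with h
  · rw [h, Nat.mod_self]
  · exact Nat.mod_eq_of_lt (by omega)

theorem val_neg_eq_ite {n : ℕ} [NeZero n] (i : ZMod n) :
    (-i).val = if i.val = 0 then 0 else n - i.val := by
  rw [ZMod.neg_val]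
  simp only [ZMod.val_eq_zero]

theorem val_neg_one_sub {n : ℕ} [NeZero n] (i : ZMod n) : (-1 - i).val = n - 1 - i.val := by
  have h : -1 - i = -(i + 1) := by ring
  have hi := i.val_lt
  rw [h, val_neg_eq_ite, val_add_one_eq_ite]
  by_cases hin : i.val + 1 = n
  · simp only [hin, if_true]
    omega
  · simp only [hin, if_false, Nat.add_eq_zero_iff, one_ne_zero, and_false]
    omega

theorem isCyclicLucas_comp_sub {n : ℕ} (c : ZMod n) (u : ZMod n → Bool) :
    IsCyclicLucas (fun i => u (i - c)) ↔ IsCyclicLucas u := by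
  constructor
  · intro h i
    have := h (i + c)
    simpa only [add_sub_cancel_right, add_sub_right_comm] using this
  · intro h i
    have := h (i - c)
    simpa only [sub_add_eq_add_sub] using this

/-- A reflection through a position. -/
theorem card_fixedBy_sr_vertex {n : ℕ} [NeZero n] (a c : ZMod n) (hac : -a = 2 * c) :
    Nat.card (MulAction.fixedBy (CyclicLucasWord n) (DihedralGroup.sr a)) =
      fibonacciCount (n / 2) (fun _ b => !(decide (n % 2 = 1) && b)) := by
  have hn := NeZero.pos n
  -- Cyclic distance to the centre, once `c` is moved to 0. For odd `n` the two positions at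
  -- distance `n / 2` are adjacent, so the last letter must be 0.
  let f : ZMod n → Fin (n / 2 + 1) := fun j =>
    ⟨min j.val (n - j.val), by have := j.val_lt; omega⟩
  have hfneg : ∀ j, f (-j) = f j := by
    intro j
    have := j.val_lt
    apply Fin.ext
    simp only [f, val_neg_eq_ite]
    split_ifs <;> omega
  have hfnat : ∀ k : ℕ, k ≤ n / 2 → (f k : ℕ) = k := by
    intro k hk
    simp only [f, ZMod.val_natCast_of_lt (show k < n by omega)]
    omega
  have hfeq : ∀ i j, f i = f j → i = j ∨ i = -j := by
    intro i j h
    have hi := i.val_lt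
    have hj := j.val_lt
    rw [Fin.ext_iff] at h
    simp only [f] at h
    by_cases hij : i.val = j.val
    · exact .inl (ZMod.val_injective n hij)
    · refine .inr (ZMod.val_injective n ?_)
      rw [val_neg_eq_ite]
      split_ifs <;> omega
  rw [card_fixedBy_of_fold _ (fun i => f (i - c))]
  · refine Nat.card_congr (Equiv.subtypeEquivRight fun w => ?_)
    change IsCyclicLucas (fun i => (w ∘ f) (i - c)) ↔ _
    rw [isCyclicLucas_comp_sub]
    constructor
    · intro h
      refine ⟨fun i j hij => ?_, ?_⟩
      · have e1 : f (i : ℕ) = i := Fin.ext (hfnat i (by omega))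
        have e2 : f ((i : ℕ) + 1) = j := Fin.ext (by
          rw [← Nat.cast_add_one, hfnat _ (by omega), hij])
        have := h ((i : ℕ) : ZMod n)
        rwa [Function.comp_apply, Function.comp_apply, e1, e2] at this
      · by_cases hodd : n % 2 = 1
        · have e1 : f ((n / 2 : ℕ) : ZMod n) = Fin.last _ := Fin.ext (hfnat _ le_rfl)
          have e2 : f ((n / 2 : ℕ) + 1) = Fin.last _ := Fin.ext (by
            simp only [f, val_add_one_eq_ite, ZMod.val_natCast_of_lt (show n / 2 < n by omega),
              Fin.val_last]
            split_ifs <;> omega)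
          have := h ((n / 2 : ℕ) : ZMod n)
          rw [Function.comp_apply, Function.comp_apply, e1, e2] at this
          simpa [hodd] using this
        · simp [hodd]
    · rintro ⟨h1, h2⟩ i
      have hi := i.val_lt
      have hcases : (f (i + 1) : ℕ) = f i + 1 ∨ (f i : ℕ) = f (i + 1) + 1 ∨
          (n % 2 = 1 ∧ (f i : ℕ) = n / 2) := by
        simp only [f, val_add_one_eq_ite]
        split_ifs <;> omega
      rcases hcases with h | h | ⟨hodd, h⟩
      · exact h1 _ _ h
      · rw [and_comm]
        exact h1 _ _ h
      · have e : f i = Fin.last _ := Fin.ext h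
        simp only [Function.comp_apply, e]
        simp only [hodd, decide_true, Bool.true_and, Bool.not_eq_true'] at h2
        simp [h2]
  · intro k
    refine ⟨(k : ℕ) + c, Fin.ext ?_⟩
    simp only [add_sub_cancel_right]
    exact hfnat k (by omega)
  · intro i
    rw [DihedralGroup.inv_sr, sr_smul_zmod, ← hfneg]
    congr 1
    rw [hac]
    ring
  · intro u hu i j hij
    rcases hfeq _ _ hij with h | h
    · rw [sub_left_injective h]
    · rw [← hu j, DihedralGroup.inv_sr, sr_smul_zmod]
      congr 1
      linear_combination h - hac

/-- A reflection through no position. -/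
theorem card_fixedBy_sr_edge {m : ℕ} (a c : ZMod (2 * (m + 1)))
    (hac : -a = 2 * c - 1) :
    Nat.card (MulAction.fixedBy (CyclicLucasWord (2 * (m + 1))) (DihedralGroup.sr a)) =
      fibonacciCount m (fun a b => !a && !b) := by
  have : NeZero (2 * (m + 1)) := ⟨by omega⟩
  -- The reflection becomes `j ↦ -1 - j` once `c` is moved to 0. It swaps the adjacent pairs `-1, 0`
  -- and `m, m + 1`, so both end letters must be 0.
  let f : ZMod (2 * (m + 1)) → Fin (m + 1) := fun j =>
    ⟨min j.val (2 * (m + 1) - 1 - j.val), by have := j.val_lt; omega⟩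
  have hfneg : ∀ j, f (-1 - j) = f j := by
    intro j
    have := j.val_lt
    apply Fin.ext
    simp only [f, val_neg_one_sub]
    omega
  have hfnat : ∀ k : ℕ, k ≤ m → (f k : ℕ) = k := by
    intro k hk
    simp only [f, ZMod.val_natCast_of_lt (show k < 2 * (m + 1) by omega)]
    omega
  have hfeq : ∀ i j, f i = f j → i = j ∨ i = -1 - j := by
    intro i j h
    have hi := i.val_lt
    have hj := j.val_lt
    rw [Fin.ext_iff] at h
    simp only [f] at h
    by_cases hij : i.val = j.val
    · exact .inl (ZMod.val_injective _ hij)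
    · refine .inr (ZMod.val_injective _ ?_)
      rw [val_neg_one_sub]
      omega
  rw [card_fixedBy_of_fold _ (fun i => f (i - c))]
  · refine Nat.card_congr (Equiv.subtypeEquivRight fun w => ?_)
    change IsCyclicLucas (fun i => (w ∘ f) (i - c)) ↔ _
    rw [isCyclicLucas_comp_sub]
    constructor
    · intro h
      have hfirst : w 0 = false := by
        have e1 : f (-1) = 0 := by
          have := hfneg 0
          rw [sub_zero] at this
          rw [this]
          exact Fin.ext (by simp [f])
        have e2 : f (-1 + 1) = 0 := by
          rw [neg_add_cancel]
          exact Fin.ext (by simp [f])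
        have := h (-1)
        rw [Function.comp_apply, Function.comp_apply, e1, e2] at this
        simpa using this
      have hlast : w (Fin.last m) = false := by
        have e1 : f (m : ℕ) = Fin.last m := Fin.ext (hfnat _ le_rfl)
        have e2 : f ((m : ℕ) + 1) = Fin.last m := Fin.ext (by
          simp only [f, val_add_one_eq_ite,
            ZMod.val_natCast_of_lt (show m < 2 * (m + 1) by omega), Fin.val_last]
          split_ifs <;> omega)
        have := h ((m : ℕ) : ZMod _)
        rw [Function.comp_apply, Function.comp_apply, e1, e2] at this
        simpa using this
      refine ⟨fun i j hij => ?_, by simp [hfirst, hlast]⟩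
      have e1 : f (i : ℕ) = i := Fin.ext (hfnat i (by omega))
      have e2 : f ((i : ℕ) + 1) = j := Fin.ext (by
        rw [← Nat.cast_add_one, hfnat _ (by omega), hij])
      have := h ((i : ℕ) : ZMod _)
      rwa [Function.comp_apply, Function.comp_apply, e1, e2] at this
    · rintro ⟨h1, h2⟩ i
      have hi := i.val_lt
      simp only [Bool.and_eq_true, Bool.not_eq_true'] at h2
      have hcases : (f (i + 1) : ℕ) = f i + 1 ∨ (f i : ℕ) = f (i + 1) + 1 ∨
          (f i : ℕ) = 0 ∨ (f i : ℕ) = m := by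
        simp only [f, val_add_one_eq_ite]
        split_ifs <;> omega
      rcases hcases with h | h | h | h
      · exact h1 _ _ h
      · rw [and_comm]
        exact h1 _ _ h
      · have e : f i = 0 := Fin.ext h
        simp [e, h2.1]
      · have e : f i = Fin.last m := Fin.ext h
        simp [e, h2.2]
  · intro k
    refine ⟨(k : ℕ) + c, Fin.ext ?_⟩
    simp only [add_sub_cancel_right]
    exact hfnat k (by omega)
  · intro i
    rw [DihedralGroup.inv_sr, sr_smul_zmod, ← hfneg]
    congr 1
    rw [hac]
    ring
  · intro u hu i j hij
    rcases hfeq _ _ hij with h | h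
    · rw [sub_left_injective h]
    · rw [← hu j, DihedralGroup.inv_sr, sr_smul_zmod]
      congr 1
      linear_combination h - hac

/-- For even `n` the two types of reflection alternate with the parity of `a`; for odd `n` all pass
through a position. Pairing consecutive reflections gives one formula for both parities. -/
theorem card_fixedBy_sr_add_succ {n : ℕ} [NeZero n] (a : ZMod n) :
    Nat.card (MulAction.fixedBy (CyclicLucasWord n) (DihedralGroup.sr a)) +
      Nat.card (MulAction.fixedBy (CyclicLucasWord n) (DihedralGroup.sr (a + 1))) =
        2 * Nat.fib (n / 2 + 2) := by
  rcases Nat.even_or_odd' n with ⟨h, rfl | rfl⟩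
  · have hh : h ≠ 0 := by have := NeZero.ne (2 * h); omega
    obtain ⟨m, rfl⟩ : ∃ m, h = m + 1 := Nat.exists_eq_succ_of_ne_zero hh
    have hv : ∀ b c : ZMod (2 * (m + 1)), -b = 2 * c →
        Nat.card (MulAction.fixedBy (CyclicLucasWord (2 * (m + 1))) (DihedralGroup.sr b)) =
          Nat.fib (m + 4) := by
      intro b c hbc
      rw [card_fixedBy_sr_vertex b c hbc, fibonacciCount_eq]
      have e1 : Nat.fib (m + 2) = _ := Nat.fib_add_two (n := m)
      have e2 : Nat.fib (m + 3) = _ := Nat.fib_add_two (n := m + 1)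
      have e3 : Nat.fib (m + 4) = _ := Nat.fib_add_two (n := m + 2)
      have e4 : 2 * (m + 1) / 2 = m + 1 := by omega
      have e5 : 2 * (m + 1) % 2 ≠ 1 := by omega
      simp only [e4, e5, decide_false, Bool.false_and, Bool.not_false, Bool.toNat_true, Nat.add_assoc,
        Nat.reduceAdd] at e1 e2 e3 ⊢
      omega
    have he : ∀ b c : ZMod (2 * (m + 1)), -b = 2 * c - 1 →
        Nat.card (MulAction.fixedBy (CyclicLucasWord (2 * (m + 1))) (DihedralGroup.sr b)) =
          Nat.fib (m + 1) := by
      intro b c hbc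
      rw [card_fixedBy_sr_edge b c hbc, fibonacciCount_eq]
      simp
    have hfib : Nat.fib (m + 4) + Nat.fib (m + 1) = 2 * Nat.fib (2 * (m + 1) / 2 + 2) := by
      have e2 : Nat.fib (m + 3) = _ := Nat.fib_add_two (n := m + 1)
      have e3 : Nat.fib (m + 4) = _ := Nat.fib_add_two (n := m + 2)
      have e4 : 2 * (m + 1) / 2 + 2 = m + 3 := by omega
      rw [e4]
      simp only [Nat.add_assoc, Nat.reduceAdd] at e2 e3
      omega
    rw [← hfib]
    have ha : ((a.val : ℕ) : ZMod (2 * (m + 1))) = a := ZMod.natCast_zmod_val a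
    rcases Nat.even_or_odd' a.val with ⟨t, ht | ht⟩ <;> rw [ht] at ha <;> push_cast at ha
    · rw [hv a (-t) (by rw [← ha]; ring), he (a + 1) (-t) (by rw [← ha]; ring)]
    · rw [he a (-t) (by rw [← ha]; ring), hv (a + 1) (-t - 1) (by rw [← ha]; ring), add_comm]
  · have hv : ∀ b : ZMod (2 * h + 1),
        Nat.card (MulAction.fixedBy (CyclicLucasWord (2 * h + 1)) (DihedralGroup.sr b)) =
          Nat.fib (h + 2) := by
      intro b
      have h0 : (2 * h + 1 : ZMod (2 * h + 1)) = 0 := by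
        have := ZMod.natCast_self (2 * h + 1)
        push_cast at this
        exact this
      -- Modulo `2 * h + 1`, `2 * h = -1`, so `h * b` is the centre.
      rw [card_fixedBy_sr_vertex b (h * b) (by linear_combination -b * h0), fibonacciCount_eq]
      have e4 : (2 * h + 1) / 2 = h := by omega
      have e5 : (2 * h + 1) % 2 = 1 := by omega
      simp only [e4, e5, decide_true, Bool.true_and, Bool.not_false, Bool.not_true,
        Bool.toNat_true, Bool.toNat_false, Nat.fib_add_two]
      ring
    rw [hv, hv, ← two_mul]
    congr 3
    omega

/-! ### Burnside summation and the binomial sum -/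

theorem sum_card_fixedBy_sr (n : ℕ) [NeZero n] :
    ∑ a : ZMod n, Nat.card (MulAction.fixedBy (CyclicLucasWord n) (DihedralGroup.sr a)) =
      n * Nat.fib (n / 2 + 2) := by
  have h := Finset.sum_congr rfl fun (a : ZMod n) (_ : a ∈ Finset.univ) =>
    card_fixedBy_sr_add_succ a
  have hshift := Equiv.sum_comp (Equiv.addRight (1 : ZMod n)) fun a =>
    Nat.card (MulAction.fixedBy (CyclicLucasWord n) (DihedralGroup.sr a))
  simp only [Equiv.coe_addRight] at hshift
  rw [Finset.sum_add_distrib, hshift, Finset.sum_const,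
    Finset.card_univ, ZMod.card, smul_eq_mul] at h
  linarith

theorem sum_zmod_eq_sum_range (n : ℕ) [NeZero n] (f : ZMod n → ℕ) :
    ∑ a : ZMod n, f a = ∑ k ∈ Finset.range n, f k := by
  refine Finset.sum_bij' (fun a _ => a.val) (fun k _ => (k : ZMod n)) ?_ ?_ ?_ ?_ ?_
  · intro a _
    simpa using a.val_lt
  · simp
  · simp
  · intro k hk
    exact ZMod.val_natCast_of_lt (Finset.mem_range.mp hk)
  · simp

/-- Rotations are grouped by `d = gcd(n, k)`; each divisor `d` arises from `φ(n / d)` of them. -/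
theorem sum_card_fixedBy_r (n : ℕ) [NeZero n] :
    ∑ a : ZMod n, Nat.card (MulAction.fixedBy (CyclicLucasWord n) (DihedralGroup.r a)) =
      ∑ d ∈ n.divisors, Nat.totient (n / d) * lucasNumber d := by
  rw [sum_zmod_eq_sum_range]
  simp only [card_fixedBy_r]
  rw [← Finset.sum_fiberwise_of_maps_to (g := fun k => n.gcd k) (t := n.divisors)
    fun k _ => Nat.mem_divisors.mpr ⟨Nat.gcd_dvd_left n k, NeZero.ne n⟩]
  refine Finset.sum_congr rfl fun d hd => ?_
  rw [Nat.totient_div_of_dvd (Nat.dvd_of_mem_divisors hd), Finset.card_eq_sum_ones,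
    Finset.sum_mul]
  refine Finset.sum_congr rfl fun k hk => ?_
  rw [(Finset.mem_filter.mp hk).2, one_mul]

theorem sum_choose_eq_fib (h : ℕ) :
    ∑ a ∈ Finset.range (h + 1), Nat.choose (h - (a + 1) / 2) (a / 2) = Nat.fib (h + 2) := by
  induction h using Nat.twoStepInduction with
  | zero => rfl
  | one => rfl
  | more h h1 h2 =>
    rw [Finset.sum_range_succ', Finset.sum_range_succ'] at h2 ⊢
    rw [Nat.fib_add_two, ← h1, ← h2]
    -- Pascal's rule: raising `a` by 2 raises the lower index by 1.
    have hstep : ∀ a ∈ Finset.range (h + 1),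
        Nat.choose (h + 2 - (a + 1 + 1 + 1) / 2) ((a + 1 + 1) / 2) =
          Nat.choose (h - (a + 1) / 2) (a / 2) +
            Nat.choose (h + 1 - (a + 1 + 1 + 1) / 2) ((a + 1 + 1) / 2) := by
      intro a ha
      rw [Finset.mem_range] at ha
      have e1 : h + 2 - (a + 1 + 1 + 1) / 2 = h - (a + 1) / 2 + 1 := by omega
      have e2 : h + 1 - (a + 1 + 1 + 1) / 2 = h - (a + 1) / 2 := by omega
      have e3 : (a + 1 + 1) / 2 = a / 2 + 1 := by omega
      rw [e1, e2, e3, Nat.choose_succ_succ]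
    rw [Finset.sum_congr rfl hstep, Finset.sum_add_distrib, Finset.sum_range_succ
      (fun a => Nat.choose (h + 1 - (a + 1 + 1 + 1) / 2) ((a + 1 + 1) / 2)) h]
    -- The range for `h + 1` is one term shorter; the surplus term vanishes.
    rw [Nat.choose_eq_zero_of_lt (n := h + 1 - (h + 1 + 1 + 1) / 2) (by omega)]
    simp
    ring

/-- Burnside's lemma needs no faithfulness, so `n ≤ 2`, where the dihedral action is not faithful,
requires no separate treatment. -/
theorem card_orbits_mul (n : ℕ) [NeZero n] :
    vertexOrbitCount (lucasCube n) * (2 * n) =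
      ∑ d ∈ n.divisors, Nat.totient (n / d) * lucasNumber d + n * Nat.fib (n / 2 + 2) := by
  classical
  have hB := MulAction.sum_card_fixedBy_eq_card_orbits_mul_card_group (DihedralGroup n)
    (CyclicLucasWord n)
  simp only [← Nat.card_eq_fintype_card] at hB
  rw [DihedralGroup.nat_card] at hB
  rw [vertexOrbitCount_lucasCube]
  refine hB.symm.trans ?_
  rw [← DihedralGroup.equivSum.symm.sum_comp, Fintype.sum_sum_type, ← sum_card_fixedBy_r,
    ← sum_card_fixedBy_sr]
  rfl

theorem mainTheorem1 (n : ℕ) (hn : 1 ≤ n) :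
    (vertexOrbitCount (lucasCube n) : ℚ) =
      (1 / 2) * ((1 / (n : ℚ)) * ∑ d ∈ n.divisors, (Nat.totient (n / d) : ℚ) * (lucasNumber d : ℚ)
        + ∑ a ∈ Finset.Icc 0 (n / 2), (Nat.choose (n / 2 - (a + 1) / 2) (a / 2) : ℚ)) := by
  have : NeZero n := ⟨by omega⟩
  have hn0 : (n : ℚ) ≠ 0 := by exact_mod_cast NeZero.ne n
  have hfib : ∑ a ∈ Finset.Icc 0 (n / 2), (Nat.choose (n / 2 - (a + 1) / 2) (a / 2) : ℚ) =
      Nat.fib (n / 2 + 2) := by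
    rw [← sum_choose_eq_fib, Nat.cast_sum, Nat.range_eq_Icc_zero_sub_one _ (Nat.succ_ne_zero _)]
    rfl
  have h := congrArg (Nat.cast : ℕ → ℚ) (card_orbits_mul n)
  push_cast at h
  rw [hfib]
  field_simp
  linear_combination h
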